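/- Let $\mathbb{F}$ be the real or the complex field and let $1\le p<\infty$. Let $\mathcal{W}$ be the set of all non-increasing sequences $(w_n)_{n=1}^\infty$ of positive numbers with $w_1=1$, $\lim_n w_n=0$ and $\sum_{n=1}^\infty w_n=\infty$. For $\mathbf{w}=(w_n)_{n=1}^\infty\in\mathcal{W}$, the Garling sequence space $g(\mathbf{w},p)$ is the Banach space of all sequences $f=(a_n)_{n=1}^\infty$ in $\mathbb{F}$ with $$\|f\|_{g(\mathbf{w},p)}=\sup_{\phi}\Big(\sum_{n=1}^\infty |a_{\phi(n)}|^p\,w_n\Big)^{1/p}<\infty,$$ where the supremum is over all (strictly) increasing maps $\phi\colon\mathbb{N}\to\mathbb{N}$. The weight $\mathbf{w}$ is called regular if there is a constant $C\ge 1$ such that $\frac1m\sum_{n=1}^m w_n\le C\,w_m$ for all $m\in\mathbb{N}$. Corollary. Let $1\le p<\infty$ and let $\mathbf{v}=(v_n)_{n=1}^\infty$, $\mathbf{w}=(w_n)_{n=1}^\infty\in\mathcal{W}$. (i) The spaces $g(\mathbf{v},p)$ and $g(\mathbf{w},p)$ are isomorphic (that is, there is an $\mathbb{F}$-linear homeomorphism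 of one onto the other) if and only if $g(\mathbf{v},p)=g(\mathbf{w},p)$ as sets of sequences. (ii) If $\mathbf{v}$ and $\mathbf{w}$ are both regular and $g(\mathbf{v},p)=g(\mathbf{w},p)$ as sets of sequences, then $v_n\approx w_n$ for $n\in\mathbb{N}$, that is, $\sup_{n} v_n/w_n<\infty$ and $\sup_{n} w_n/v_n<\infty$. -/

import Mathlib

open scoped ENNReal
open Filter Topology

/-- The set of weights `𝒲`: the non-increasing sequences of positive numbers in `c₀ ∖ ℓ₁` whose
first term is `1`. Sequences are indexed from `0`, so `w n` is the term `w_{n+1}` of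
`(w_n)_{n=1}^∞`. -/
structure GarlingWeight where
  /-- The underlying sequence. -/
  toFun : ℕ → ℝ
  first_eq_one : toFun 0 = 1
  antitone : Antitone toFun
  pos : ∀ n, 0 < toFun n
  tendsto_zero : Tendsto toFun atTop (𝓝 0)
  not_summable : ¬ Summable toFun

instance : CoeFun GarlingWeight (fun _ => ℕ → ℝ) := ⟨GarlingWeight.toFun⟩

/-- A weight is regular if `(1/m) ∑_{n=1}^m w_n ≤ C w_m` for some `C ≥ 1` and all `m ≥ 1`
(with indices shifted by one). -/
def GarlingWeight.IsRegular (w : GarlingWeight) : Prop :=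
  ∃ C : ℝ, 1 ≤ C ∧ ∀ m : ℕ, (1 / ((m : ℝ) + 1)) * ∑ n ∈ Finset.range (m + 1), w n ≤ C * w m

/-- `α_i ≲ β_i` for `i ∈ I`, i.e. `sup_i α_i / β_i < ∞`, for families of positive numbers. -/
def FamLesssim {I : Type*} (α β : I → ℝ) : Prop :=
  BddAbove (Set.range fun i => α i / β i)

/-- `α_i ≈ β_i` for `i ∈ I`, for families of positive numbers. -/
def FamApprox {I : Type*} (α β : I → ℝ) : Prop :=
  FamLesssim α β ∧ FamLesssim β α

section Garling

variable {𝕜 : Type*} [RCLike 𝕜]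

/-- The weighted `ℓ_p` functional `(∑_n |a_n|^p w_n)^{1/p} ∈ [0, ∞]`. -/
noncomputable def weightedLpENorm (w : GarlingWeight) (p : ℝ) (f : ℕ → 𝕜) : ℝ≥0∞ :=
  (∑' n, ‖f n‖ₑ ^ p * ENNReal.ofReal (w n)) ^ (1 / p)

/-- The Garling norm `sup_φ (∑_n |a_{φ(n)}|^p w_n)^{1/p} ∈ [0, ∞]`, where `φ` ranges over the
(strictly) increasing maps from `ℕ` to `ℕ`. -/
noncomputable def garlingENorm (w : GarlingWeight) (p : ℝ) (f : ℕ → 𝕜) : ℝ≥0∞ :=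
  ⨆ φ : {φ : ℕ → ℕ // StrictMono φ}, weightedLpENorm w p (fun n => f (φ.1 n))

theorem weightedLpENorm_add_le (w : GarlingWeight) {p : ℝ} (hp : 1 ≤ p) (f g : ℕ → 𝕜) :
    weightedLpENorm w p (f + g) ≤ weightedLpENorm w p f + weightedLpENorm w p g := by
  let μ : MeasureTheory.Measure ℕ := MeasureTheory.Measure.sum
    fun n => ENNReal.ofReal (w n) • MeasureTheory.Measure.dirac n
  have key : ∀ h : ℕ → ℝ≥0∞, ∫⁻ n, h n ∂μ = ∑' n, h n * ENNReal.ofReal (w n) := by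
    intro h
    simp [μ, MeasureTheory.lintegral_sum_measure, mul_comm]
  have hm := ENNReal.lintegral_Lp_add_le (μ := μ) (f := fun n => ‖f n‖ₑ) (g := fun n => ‖g n‖ₑ)
    (measurable_of_countable _).aemeasurable (measurable_of_countable _).aemeasurable hp
  simp only [key, Pi.add_apply] at hm
  refine le_trans ?_ hm
  unfold weightedLpENorm
  have h0 : 0 ≤ p := zero_le_one.trans hp
  refine ENNReal.rpow_le_rpow (ENNReal.tsum_le_tsum fun n => ?_) (by positivity)
  gcongr
  exact enorm_add_le _ _

theorem garlingENorm_add_le (w : GarlingWeight) {p : ℝ} (hp : 1 ≤ p) (f g : ℕ → 𝕜) :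
    garlingENorm w p (f + g) ≤ garlingENorm w p f + garlingENorm w p g :=
  iSup_le fun φ => (weightedLpENorm_add_le w hp (fun n => f (φ.1 n)) (fun n => g (φ.1 n))).trans
    (add_le_add (le_iSup (fun φ : {φ : ℕ → ℕ // StrictMono φ} =>
        weightedLpENorm w p (fun n => f (φ.1 n))) φ)
      (le_iSup (fun φ : {φ : ℕ → ℕ // StrictMono φ} =>
        weightedLpENorm w p (fun n => g (φ.1 n))) φ))

theorem weightedLpENorm_smul (w : GarlingWeight) {p : ℝ} (hp : 1 ≤ p) (c : 𝕜) (f : ℕ → 𝕜) :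
    weightedLpENorm w p (c • f) = ‖c‖ₑ * weightedLpENorm w p f := by
  have h0 : 0 < p := zero_lt_one.trans_le hp
  unfold weightedLpENorm
  simp only [Pi.smul_apply, enorm_smul, ENNReal.mul_rpow_of_nonneg _ _ h0.le, mul_assoc]
  rw [ENNReal.tsum_mul_left, ENNReal.mul_rpow_of_nonneg _ _ (by positivity : 0 ≤ 1 / p),
    ← ENNReal.rpow_mul, mul_one_div_cancel h0.ne', ENNReal.rpow_one]

theorem garlingENorm_smul (w : GarlingWeight) {p : ℝ} (hp : 1 ≤ p) (c : 𝕜) (f : ℕ → 𝕜) :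
    garlingENorm w p (c • f) = ‖c‖ₑ * garlingENorm w p f := by
  unfold garlingENorm
  rw [ENNReal.mul_iSup]
  exact iSup_congr fun φ => weightedLpENorm_smul w hp c (fun n => f (φ.1 n))

theorem garlingENorm_zero (w : GarlingWeight) {p : ℝ} (hp : 1 ≤ p) :
    garlingENorm w p (0 : ℕ → 𝕜) = 0 := by
  simpa using garlingENorm_smul w hp (0 : 𝕜) (0 : ℕ → 𝕜)

theorem eq_zero_of_garlingENorm_eq_zero (w : GarlingWeight) {p : ℝ} (hp : 1 ≤ p) {f : ℕ → 𝕜}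
    (hf : garlingENorm w p f = 0) : f = 0 := by
  have h0 : 0 < p := zero_lt_one.trans_le hp
  funext k
  have h1 : weightedLpENorm w p (fun n => f (n + k)) = 0 := by
    have := (ENNReal.iSup_eq_zero.1 hf) ⟨fun n => n + k, fun a b h => Nat.add_lt_add_right h k⟩
    exact this
  unfold weightedLpENorm at h1
  rw [ENNReal.rpow_eq_zero_iff_of_pos (by positivity), ENNReal.tsum_eq_zero] at h1
  have h2 := h1 0
  rw [mul_eq_zero, ENNReal.rpow_eq_zero_iff_of_pos h0, ENNReal.ofReal_eq_zero] at h2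
  rcases h2 with h | h
  · simpa using h
  · exact absurd (w.pos 0) (not_lt.2 h)

variable (𝕜)

/-- The scalar sequences with finite Garling norm, as a linear subspace of `𝕜^ℕ`. -/
def garlingSubmodule (w : GarlingWeight) (p : ℝ) [hp : Fact (1 ≤ p)] : Submodule 𝕜 (ℕ → 𝕜) where
  carrier := {f | garlingENorm w p f < ∞}
  zero_mem' := by simp [garlingENorm_zero w hp.out]
  add_mem' := fun {f g} hf hg =>
    (garlingENorm_add_le w hp.out f g).trans_lt (ENNReal.add_lt_top.2 ⟨hf, hg⟩)
  smul_mem' := fun c f hf => by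
    simp only [Set.mem_ofPred_eq, garlingENorm_smul w hp.out]
    exact ENNReal.mul_lt_top enorm_lt_top hf

/-- The Garling sequence space `g(w, p)` over `𝕜`. It is a type of its own, so that its topology is
that of the Garling norm and not the one of coordinatewise convergence. -/
def GarlingSpace (w : GarlingWeight) (p : ℝ) [Fact (1 ≤ p)] : Type _ :=
  ↥(garlingSubmodule 𝕜 w p)

namespace GarlingSpace

variable (w : GarlingWeight) (p : ℝ) [hp : Fact (1 ≤ p)]

instance : AddCommGroup (GarlingSpace 𝕜 w p) :=
  inferInstanceAs (AddCommGroup ↥(garlingSubmodule 𝕜 w p))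

instance : Module 𝕜 (GarlingSpace 𝕜 w p) :=
  inferInstanceAs (Module 𝕜 ↥(garlingSubmodule 𝕜 w p))

/-- The norm of `g(w, p)`, a finite number on this space. -/
noncomputable instance : Norm (GarlingSpace 𝕜 w p) :=
  ⟨fun f => (garlingENorm w p f.1).toReal⟩

theorem normedSpaceCore : NormedSpace.Core 𝕜 (GarlingSpace 𝕜 w p) where
  norm_nonneg _ := ENNReal.toReal_nonneg
  norm_smul c f := by
    change (garlingENorm w p (c • f.1)).toReal = _ * (garlingENorm w p f.1).toReal
    rw [garlingENorm_smul w hp.out, ENNReal.toReal_mul, toReal_enorm]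
  norm_triangle f g := by
    have hf : garlingENorm w p f.1 ≠ ∞ := ne_of_lt f.2
    have hg : garlingENorm w p g.1 ≠ ∞ := ne_of_lt g.2
    change (garlingENorm w p (f.1 + g.1)).toReal ≤
      (garlingENorm w p f.1).toReal + (garlingENorm w p g.1).toReal
    rw [← ENNReal.toReal_add hf hg]
    exact ENNReal.toReal_mono (ENNReal.add_ne_top.2 ⟨hf, hg⟩) (garlingENorm_add_le w hp.out _ _)
  norm_eq_zero_iff f := by
    have hf : garlingENorm w p f.1 ≠ ∞ := ne_of_lt f.2
    constructor
    · intro h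
      have h' : garlingENorm w p f.1 = 0 :=
        ((ENNReal.toReal_eq_zero_iff _).1 h).resolve_right hf
      exact Subtype.ext (eq_zero_of_garlingENorm_eq_zero w hp.out h')
    · rintro rfl
      change (garlingENorm w p (0 : ℕ → 𝕜)).toReal = 0
      rw [garlingENorm_zero w hp.out, ENNReal.toReal_zero]

noncomputable instance : NormedAddCommGroup (GarlingSpace 𝕜 w p) :=
  NormedAddCommGroup.ofCore (normedSpaceCore 𝕜 w p)

noncomputable instance : NormedSpace 𝕜 (GarlingSpace 𝕜 w p) :=
  NormedSpace.ofCore (normedSpaceCore 𝕜 w p)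

end GarlingSpace

end Garling

/-! ### Garling norm: finite sums, spreading, indicators, selection of coordinates. -/

section GarlingNorm

variable {𝕜 : Type*} [RCLike 𝕜] (w : GarlingWeight) {p : ℝ}

/-! Let `T` be an isomorphism of `g(v,p)` onto `g(w,p)`. Differences of a suitable subsequence of
the unit vectors have images `x k` that tend to zero coordinatewise and are bounded below in norm.
Averaging over signs (`garlingENorm_select_le`) shows that any sequence taking its `j`-th coordinate
from one of the `a k • x k` has `w`-norm at most a constant times the `v`-norm of `a`. If the sup
norms of the `x k` do not tend to zero, picking one large coordinate from each of infinitely many `x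
k` bounds the `w`-norm of `a` by a multiple of its `v`-norm (`garlingENorm_le_of_frequently_le`). If
they do, disjoint pieces of `N` of the `x k` join to a sequence whose norm to the power `p` is at
least a multiple of `N`, whereas the partial sums of `v` are `o(N)`, a contradiction
(`false_of_uniformly_small`). The Fatou property removes the finite support of `a`, and `T.symm`
gives the other inclusion. Conversely, if the spaces coincide, the closed graph theorem makes the
identity an isomorphism. Testing it on indicators of initial segments compares the partial sums of
the weights, which for regular weights compares the weights themselves. -/

theorem weightedLpENorm_le_iff (hp : 0 < p) {f : ℕ → 𝕜} {B : ℝ≥0∞} :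
    weightedLpENorm w p f ≤ B ↔
      ∀ F : Finset ℕ, ∑ n ∈ F, ‖f n‖ₑ ^ p * ENNReal.ofReal (w n) ≤ B ^ p := by
  unfold weightedLpENorm
  rw [one_div, ENNReal.rpow_inv_le_iff hp, ENNReal.tsum_eq_iSup_sum, iSup_le_iff]

theorem garlingENorm_le_iff (hp : 0 < p) {f : ℕ → 𝕜} {B : ℝ≥0∞} :
    garlingENorm w p f ≤ B ↔ ∀ φ : ℕ → ℕ, StrictMono φ →
      ∀ F : Finset ℕ, ∑ n ∈ F, ‖f (φ n)‖ₑ ^ p * ENNReal.ofReal (w n) ≤ B ^ p := by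
  unfold garlingENorm
  simp only [iSup_le_iff, weightedLpENorm_le_iff w hp, Subtype.forall]

theorem weightedLpENorm_comp_le_garlingENorm (f : ℕ → 𝕜) {φ : ℕ → ℕ} (hφ : StrictMono φ) :
    weightedLpENorm w p (fun n => f (φ n)) ≤ garlingENorm w p f :=
  le_iSup (fun φ : {φ : ℕ → ℕ // StrictMono φ} => weightedLpENorm w p (fun n => f (φ.1 n)))
    ⟨φ, hφ⟩

theorem garlingENorm_mono (hp : 0 < p) {f g : ℕ → 𝕜} (h : ∀ n, ‖f n‖ₑ ≤ ‖g n‖ₑ) :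
    garlingENorm w p f ≤ garlingENorm w p g := by
  rw [garlingENorm_le_iff w hp]
  intro φ hφ F
  refine le_trans (Finset.sum_le_sum fun n _ => ?_) ((garlingENorm_le_iff w hp).1 le_rfl φ hφ F)
  gcongr
  exact h _

theorem enorm_apply_le_garlingENorm (hp : 0 < p) (f : ℕ → 𝕜) (j : ℕ) :
    ‖f j‖ₑ ≤ garlingENorm w p f := by
  have h := (garlingENorm_le_iff w hp).1 (le_refl (garlingENorm w p f)) (fun n => n + j)
    (fun a b h => Nat.add_lt_add_right h j) {0}
  simpa [w.first_eq_one, ENNReal.rpow_le_rpow_iff hp] using h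

/-- Fatou property of the Garling norm. -/
theorem garlingENorm_le_of_tendsto (hp : 0 < p) {ι : Type*} {l : Filter ι} [l.NeBot]
    {u : ι → ℕ → 𝕜} {f : ℕ → 𝕜} (hu : ∀ j, Tendsto (fun i => u i j) l (𝓝 (f j))) {B : ℝ≥0∞}
    (hB : ∀ᶠ i in l, garlingENorm w p (u i) ≤ B) : garlingENorm w p f ≤ B := by
  rw [garlingENorm_le_iff w hp]
  intro φ hφ F
  have hlim : Tendsto (fun i => ∑ n ∈ F, ‖u i (φ n)‖ₑ ^ p * ENNReal.ofReal (w n)) l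
      (𝓝 (∑ n ∈ F, ‖f (φ n)‖ₑ ^ p * ENNReal.ofReal (w n))) := by
    refine tendsto_finsetSum _ fun n _ => ?_
    refine ENNReal.Tendsto.mul_const ?_ (Or.inr ENNReal.ofReal_ne_top)
    exact ((ENNReal.continuous_rpow_const (y := p)).tendsto _).comp (hu (φ n)).enorm
  refine le_of_tendsto hlim ?_
  filter_upwards [hB] with i hi
  exact (garlingENorm_le_iff w hp).1 hi φ hφ F

/-- The Garling norm bounds the sums in which each element of a finite set is weighted according
to its rank in that set. -/
theorem sum_rank_le_garlingENorm (hp : 0 < p) (f : ℕ → 𝕜) (A : Finset ℕ) :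
    ∑ a ∈ A, ‖f a‖ₑ ^ p * ENNReal.ofReal (w (A.filter (· < a)).card) ≤
      garlingENorm w p f ^ p := by
  classical
  -- Everything beyond `A` is added so that the enumeration `Nat.nth P` is a strictly increasing map
  -- on all of `ℕ`; it lists `A` first, so counting gives the rank in `A`.
  let P : ℕ → Prop := fun m => m ∈ A ∨ ∀ b ∈ A, b < m
  have hinf : (Set.ofPred P).Infinite := by
    obtain ⟨M, hM⟩ := A.bddAbove
    refine Set.infinite_of_not_bddAbove fun ⟨K, hK⟩ => ?_
    have : max K M + 1 ∈ Set.ofPred P :=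
      Or.inr fun b hb => Nat.lt_succ_of_le ((hM hb).trans (le_max_right _ _))
    have := hK this
    omega
  have hcount : ∀ a ∈ A, Nat.count P a = (A.filter (· < a)).card := by
    intro a ha
    rw [Nat.count_eq_card_filter_range]
    congr 1
    ext b
    simp only [Finset.mem_filter, Finset.mem_range, P]
    constructor
    · rintro ⟨hb, h | h⟩
      · exact ⟨h, hb⟩
      · exact absurd (h a ha) (by omega)
    · rintro ⟨h, hb⟩
      exact ⟨hb, Or.inl h⟩
  have hnth : ∀ a ∈ A, Nat.nth P (Nat.count P a) = a := fun a ha => Nat.nth_count (Or.inl ha)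
  have hinj : Set.InjOn (Nat.count P) A := fun a ha b hb h => by
    rw [← hnth a ha, ← hnth b hb, h]
  refine le_trans (le_of_eq ?_) ((garlingENorm_le_iff w hp).1 le_rfl (Nat.nth P)
    (Nat.nth_strictMono hinf) (A.image (Nat.count P)))
  rw [Finset.sum_image hinj]
  exact Finset.sum_congr rfl fun a ha => by rw [hnth a ha, hcount a ha]

/-- The rank of `ψ n` in the image of `F` is at most `n`, so ranking only increases the weights.
This admits maps that are increasing on `F` alone. -/
theorem sum_le_garlingENorm_of_strictMonoOn (hp : 0 < p) (f : ℕ → 𝕜) (F : Finset ℕ) {ψ : ℕ → ℕ}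
    (hψ : StrictMonoOn ψ F) :
    ∑ n ∈ F, ‖f (ψ n)‖ₑ ^ p * ENNReal.ofReal (w n) ≤ garlingENorm w p f ^ p := by
  classical
  refine le_trans ?_ (sum_rank_le_garlingENorm w hp f (F.image ψ))
  rw [Finset.sum_image hψ.injOn]
  refine Finset.sum_le_sum fun n hn => ?_
  gcongr
  refine w.antitone ?_
  have hsub : (F.image ψ).filter (· < ψ n) ⊆ (Finset.range n).image ψ := by
    intro b hb
    simp only [Finset.mem_filter, Finset.mem_image, Finset.mem_range] at hb ⊢
    obtain ⟨⟨m, hm, rfl⟩, h⟩ := hb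
    exact ⟨m, (hψ.lt_iff_lt hm hn).1 h, rfl⟩
  calc _ ≤ _ := Finset.card_le_card hsub
    _ ≤ _ := Finset.card_image_le
    _ = n := Finset.card_range n

/-- Spreading the terms of a sequence along an increasing map does not increase its norm. -/
theorem garlingENorm_extend_le (hp : 0 < p) (f : ℕ → 𝕜) {l : ℕ → ℕ} (hl : StrictMono l) :
    garlingENorm w p (Function.extend l f 0) ≤ garlingENorm w p f := by
  classical
  rw [garlingENorm_le_iff w hp]
  intro φ hφ F
  have hinv : ∀ n, φ n ∈ Set.range l → l (Function.invFun l (φ n)) = φ n :=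
    fun n hn => Function.invFun_eq hn
  refine le_trans (le_of_eq ?_) (sum_le_garlingENorm_of_strictMonoOn w hp f
    (F.filter fun n => φ n ∈ Set.range l) (ψ := fun n => Function.invFun l (φ n)) ?_)
  · rw [Finset.sum_filter]
    refine Finset.sum_congr rfl fun n _ => ?_
    split_ifs with h
    · conv_lhs => rw [← hinv n h, hl.injective.extend_apply]
    · rw [Function.extend_apply' _ _ _ h]
      simp [hp]
  · intro a ha b hb hab
    simp only [Finset.coe_filter, Set.mem_ofPred_eq] at ha hb
    rw [← hl.lt_iff_lt, hinv a ha.2, hinv b hb.2]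
    exact hφ hab

theorem sum_le_sum_range_card {u : ℕ → ℝ} (hu : Antitone u) (F : Finset ℕ) :
    ∑ n ∈ F, u n ≤ ∑ n ∈ Finset.range F.card, u n := by
  induction F using Finset.induction_on_max with
  | empty => simp
  | insert a s hs ih =>
    have ha : a ∉ s := fun h => lt_irrefl _ (hs a h)
    have hc : s.card ≤ a := by
      simpa using Finset.card_le_card (fun x hx => Finset.mem_range.2 (hs x hx) :
        s ⊆ Finset.range a)
    rw [Finset.sum_insert ha, Finset.card_insert_of_notMem ha, Finset.sum_range_succ, add_comm]
    exact add_le_add ih (hu hc)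

theorem garlingENorm_indicator_rpow_le (hp : 0 < p) (K : Finset ℕ) :
    garlingENorm w p (Set.indicator (K : Set ℕ) (1 : ℕ → 𝕜)) ^ p ≤
      ENNReal.ofReal (∑ n ∈ Finset.range K.card, w n) := by
  classical
  rw [← ENNReal.le_rpow_inv_iff hp, garlingENorm_le_iff w hp]
  intro φ hφ F
  rw [ENNReal.rpow_inv_rpow hp.ne']
  calc ∑ n ∈ F, ‖(K : Set ℕ).indicator (1 : ℕ → 𝕜) (φ n)‖ₑ ^ p * ENNReal.ofReal (w n)
      = ∑ n ∈ F.filter (fun n => φ n ∈ K), ENNReal.ofReal (w n) := by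
        rw [Finset.sum_filter]
        refine Finset.sum_congr rfl fun n _ => ?_
        by_cases h : φ n ∈ K <;> simp [h, hp]
    _ = ENNReal.ofReal (∑ n ∈ F.filter (fun n => φ n ∈ K), w n) :=
        (ENNReal.ofReal_sum_of_nonneg fun n _ => (w.pos n).le).symm
    _ ≤ _ := by
        refine ENNReal.ofReal_le_ofReal ((sum_le_sum_range_card w.antitone _).trans ?_)
        refine Finset.sum_le_sum_of_subset_of_nonneg ?_ fun n _ _ => (w.pos n).le
        refine Finset.range_subset_range.2 ?_
        refine Finset.card_le_card_of_injOn φ (fun n hn => ?_) hφ.injective.injOn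
        exact (Finset.mem_filter.1 hn).2

theorem sum_range_le_garlingENorm_indicator_rpow (hp : 0 < p) (N : ℕ) :
    ENNReal.ofReal (∑ n ∈ Finset.range N, w n) ≤
      garlingENorm w p (Set.indicator (Finset.range N : Set ℕ) (1 : ℕ → 𝕜)) ^ p := by
  refine le_trans (le_of_eq ?_)
    ((garlingENorm_le_iff w hp).1 le_rfl id strictMono_id (Finset.range N))
  rw [ENNReal.ofReal_sum_of_nonneg fun n _ => (w.pos n).le]
  refine Finset.sum_congr rfl fun n hn => ?_
  have : n < N := Finset.mem_range.1 hn
  simp [this]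

theorem garlingENorm_neg (hp : 0 < p) (f : ℕ → 𝕜) :
    garlingENorm w p (-f) = garlingENorm w p f :=
  le_antisymm (garlingENorm_mono w hp fun n => by simp) (garlingENorm_mono w hp fun n => by simp)

/-- The piecewise sequence is the mean of `f + g` and of `f - g` with its sign flipped on `A`; sign
flips do not change the norm. -/
theorem garlingENorm_piecewise_le (hp : 1 ≤ p) (A : Set ℕ) [DecidablePred (· ∈ A)]
    {f g : ℕ → 𝕜} {B : ℝ≥0∞} (h₁ : garlingENorm w p (f + g) ≤ B)
    (h₂ : garlingENorm w p (f - g) ≤ B) : garlingENorm w p (A.piecewise g f) ≤ B := by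
  have h0 : 0 < p := zero_lt_one.trans_le hp
  let s : ℕ → 𝕜 := A.piecewise (-(f - g)) (f - g)
  have hs : garlingENorm w p s ≤ B := le_trans (garlingENorm_mono w h0 fun n => by
    by_cases hn : n ∈ A
    · simp only [s, Set.piecewise_eq_of_mem _ _ _ hn, Pi.neg_apply, enorm_neg, le_refl]
    · simp only [s, Set.piecewise_eq_of_notMem _ _ _ hn, le_refl]) h₂
  have hsum : A.piecewise g f = (2⁻¹ : 𝕜) • ((f + g) + s) := by
    funext n
    by_cases hn : n ∈ A
    · simp only [s, Set.piecewise_eq_of_mem _ _ _ hn, Pi.neg_apply, Pi.smul_apply, Pi.add_apply,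
        Pi.sub_apply, smul_eq_mul]
      ring
    · simp only [s, Set.piecewise_eq_of_notMem _ _ _ hn, Pi.smul_apply, Pi.add_apply,
        Pi.sub_apply, smul_eq_mul]
      ring
  have h2 : ‖(2⁻¹ : 𝕜)‖ₑ = 2⁻¹ := by
    rw [enorm_inv two_ne_zero]
    congr 1
    rw [← ofReal_norm]
    simp
  rw [hsum, garlingENorm_smul w hp, h2]
  calc _ ≤ 2⁻¹ * (B + B) := by
        gcongr
        exact (garlingENorm_add_le w hp _ _).trans (add_le_add h₁ hs)
    _ = B := by rw [← two_mul, ← mul_assoc, ENNReal.inv_mul_cancel two_ne_zero (by simp), one_mul]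

/-- The remainder `r` makes the induction go through: on `{j | c j = N}` the last sequence `x N`
replaces `r` and the earlier ones are set to zero, using both signs of `x N`. -/
theorem garlingENorm_select_aux (hp : 1 ≤ p) (c : ℕ → ℕ) {B : ℝ≥0∞} (N : ℕ) :
    ∀ (r : ℕ → 𝕜) (x : ℕ → ℕ → 𝕜),
      (∀ ε : ℕ → 𝕜, (∀ k, ε k = 1 ∨ ε k = -1) →
        garlingENorm w p (r + ∑ k ∈ Finset.range N, ε k • x k) ≤ B) →
      garlingENorm w p (fun j => if c j < N then x (c j) j else r j) ≤ B := by
  classical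
  induction N with
  | zero =>
    intro r x h
    simpa using h 1 (fun _ => Or.inl rfl)
  | succ N ih =>
    intro r x h
    let A : Set ℕ := {j | c j = N}
    have key := ih (A.piecewise (x N) r) (fun k => A.piecewise 0 (x k)) (fun ε hε => by
      have hsum : A.piecewise (x N) r + ∑ k ∈ Finset.range N, ε k • A.piecewise 0 (x k) =
          A.piecewise (x N) (r + ∑ k ∈ Finset.range N, ε k • x k) := by
        funext j
        by_cases hj : j ∈ A <;> simp [hj, Finset.sum_apply]
      rw [hsum]
      have hε' : ∀ t : 𝕜, t = 1 ∨ t = -1 →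
          garlingENorm w p ((r + ∑ k ∈ Finset.range N, ε k • x k) + t • x N) ≤ B := by
        intro t ht
        have := h (Function.update ε N t) (fun k => by
          by_cases hk : k = N
          · subst hk; simpa using ht
          · simpa [hk] using hε k)
        rw [Finset.sum_range_succ, ← add_assoc] at this
        rw [Finset.sum_congr rfl fun k hk => by
          rw [Function.update_of_ne (Finset.mem_range.1 hk).ne]] at this
        simpa using this
      refine garlingENorm_piecewise_le w hp A ?_ ?_
      · simpa using hε' 1 (Or.inl rfl)
      · simpa [sub_eq_add_neg] using hε' (-1) (Or.inr rfl))
    refine le_trans (le_of_eq ?_) key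
    congr 1
    funext j
    rcases lt_trichotomy (c j) N with hj | hj | hj
    · have : j ∉ A := fun h => hj.ne h
      simp [hj, this, hj.trans (Nat.lt_succ_self N)]
    · have : j ∈ A := hj
      simp [hj, this]
    · have : j ∉ A := fun h => hj.ne' h
      simp [this, not_lt.2 hj.le, not_lt.2 (Nat.succ_le_of_lt hj)]

/-- If all signed sums of finitely many sequences are bounded by `B`, then so is every sequence
that picks each of its coordinates from one of them. -/
theorem garlingENorm_select_le (hp : 1 ≤ p) (c : ℕ → ℕ) {B : ℝ≥0∞} (N : ℕ) (x : ℕ → ℕ → 𝕜)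
    (h : ∀ ε : ℕ → 𝕜, (∀ k, ε k = 1 ∨ ε k = -1) →
      garlingENorm w p (∑ k ∈ Finset.range N, ε k • x k) ≤ B) :
    garlingENorm w p (fun j => if c j < N then x (c j) j else 0) ≤ B :=
  garlingENorm_select_aux w hp c N 0 x (by simpa using h)

end GarlingNorm

/-! ### The dichotomy for coordinatewise null sequences. -/

section Selection

variable {𝕜 : Type*} [RCLike 𝕜] (v w : GarlingWeight) {p : ℝ}

theorem exists_tendsto_subseq_of_bounded {u : ℕ → ℕ → 𝕜} {R : ℝ} (h : ∀ k j, ‖u k j‖ ≤ R) :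
    ∃ (y : ℕ → 𝕜) (m : ℕ → ℕ), StrictMono m ∧
      ∀ j, Tendsto (fun k => u (m k) j) atTop (𝓝 (y j)) := by
  have hc : IsCompact (Set.univ.pi fun _ : ℕ => Metric.closedBall (0 : 𝕜) R) :=
    isCompact_univ_pi fun _ => isCompact_closedBall 0 R
  obtain ⟨y, -, m, hm, ht⟩ := hc.tendsto_subseq (x := u) fun k j _ => by simpa using h k j
  exact ⟨y, m, hm, fun j => (tendsto_pi_nhds.1 ht) j⟩

theorem garlingENorm_le_of_frequently_le (hp : 1 ≤ p) {x : ℕ → ℕ → 𝕜} {C : ℝ≥0∞}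
    (hsel : ∀ (N : ℕ) (a : ℕ → 𝕜), (∀ k, N ≤ k → a k = 0) → ∀ c : ℕ → ℕ,
      garlingENorm w p (fun j => a (c j) * x (c j) j) ≤ C * garlingENorm v p a)
    (hx : ∀ j, Tendsto (fun k => x k j) atTop (𝓝 0)) {δ : ℝ} (hδ : 0 < δ)
    (hfreq : ∃ᶠ k in atTop, ∃ j, δ ≤ ‖x k j‖) (N : ℕ) (a : ℕ → 𝕜) (ha : ∀ k, N ≤ k → a k = 0) :
    ENNReal.ofReal δ * garlingENorm w p a ≤ C * garlingENorm v p a := by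
  have h0 : 0 < p := zero_lt_one.trans_le hp
  obtain ⟨φ, hφ, hφx⟩ := extraction_of_frequently_atTop hfreq
  choose i hi using hφx
  -- Each fixed coordinate tends to zero, so the positions of the large entries escape to infinity.
  have hitop : Tendsto i atTop atTop := by
    refine tendsto_atTop.2 fun J => ?_
    have : ∀ᶠ k in atTop, ∀ j ∈ Finset.range J, ‖x k j‖ < δ := by
      rw [Filter.eventually_all_finset]
      intro j _
      have := (hx j).norm
      rw [norm_zero] at this
      exact this.eventually_lt_const hδ
    filter_upwards [hφ.tendsto_atTop.eventually this] with n hn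
    by_contra hlt
    exact absurd (hi n) (not_le.2 (hn _ (Finset.mem_range.2 (not_le.1 hlt))))
  obtain ⟨ψ, hψ, hiψ⟩ := strictMono_subseq_of_tendsto_atTop hitop
  have hk : StrictMono (φ ∘ ψ) := hφ.comp hψ
  -- The coefficients are moved to the chosen indices, and `c` sends each chosen position to its
  -- index. Its default value off these positions is harmless, since only the chosen positions enter
  -- the lower bound.
  let a' : ℕ → 𝕜 := Function.extend (φ ∘ ψ) a 0
  let c : ℕ → ℕ := Function.extend (i ∘ ψ) (φ ∘ ψ) 0
  have ha' : ∀ k, (φ ∘ ψ) N ≤ k → a' k = 0 := by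
    intro k hNk
    by_cases hr : ∃ n, (φ ∘ ψ) n = k
    · obtain ⟨n, rfl⟩ := hr
      simp only [a', hk.injective.extend_apply]
      exact ha n (hk.le_iff_le.1 hNk)
    · simp [a', Function.extend_apply' _ _ _ hr]
  calc ENNReal.ofReal δ * garlingENorm w p a = garlingENorm w p ((δ : 𝕜) • a) := by
        rw [garlingENorm_smul w hp]
        congr 1
        rw [← ofReal_norm, RCLike.norm_ofReal, abs_of_pos hδ]
    _ ≤ garlingENorm w p (fun j => a' (c j) * x (c j) j) := by
        refine iSup_le fun θ => le_trans ?_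
          (weightedLpENorm_comp_le_garlingENorm w _ (hiψ.comp θ.2))
        unfold weightedLpENorm
        refine ENNReal.rpow_le_rpow (ENNReal.tsum_le_tsum fun n => ?_) (by positivity)
        have hcn : c ((i ∘ ψ) (θ.1 n)) = (φ ∘ ψ) (θ.1 n) := hiψ.injective.extend_apply _ _ _
        have han : a' ((φ ∘ ψ) (θ.1 n)) = a (θ.1 n) := hk.injective.extend_apply _ _ _
        have hxn : ‖(δ : 𝕜)‖ₑ ≤ ‖x (φ (ψ (θ.1 n))) (i (ψ (θ.1 n)))‖ₑ := by
          rw [enorm_le_iff_norm_le, RCLike.norm_ofReal, abs_of_pos hδ]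
          exact hi _
        simp only [Function.comp_apply] at hcn han ⊢
        rw [hcn, han, Pi.smul_apply, smul_eq_mul, enorm_mul, enorm_mul,
          mul_comm ‖(δ : 𝕜)‖ₑ]
        gcongr
    _ ≤ C * garlingENorm v p a' := hsel _ a' ha' c
    _ ≤ C * garlingENorm v p a := by
        gcongr
        exact garlingENorm_extend_le v h0 a hk

/-- When all entries are small, dropping the first `J` terms of a nearly norming sum costs little.
The weights that remain start at `w J`, so the block can be placed after any set contained in `[0,
J)`. -/
theorem exists_tail_sum_ge (hp : 0 < p) {x : ℕ → ℕ → 𝕜}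
    (hsup : ∀ δ : ℝ, 0 < δ → ∀ᶠ k in atTop, ∀ j, ‖x k j‖ < δ) {c : ℝ} (hc : 0 < c)
    (hlow : ∀ k, ENNReal.ofReal c ≤ garlingENorm w p (x k)) (J k₀ : ℕ) :
    ∃ k, k₀ ≤ k ∧ ∃ A : Finset ℕ, (∀ a ∈ A, J ≤ a) ∧
      ENNReal.ofReal (c ^ p / 4) ≤
        ∑ a ∈ A, ‖x k a‖ₑ ^ p * ENNReal.ofReal (w (J + (A.filter (· < a)).card)) := by
  classical
  -- Some sum exceeds `2 * e < c ^ p`; its first `J` terms total at most `e`, each being at most `e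
  -- / (J + 1)`, and so `e` is left.
  set e : ℝ := c ^ p / 4 with he_def
  have hcp : 0 < c ^ p := Real.rpow_pos_of_pos hc p
  have he : 0 < e := by positivity
  have hJ : (0 : ℝ) < e / (J + 1) := by positivity
  obtain ⟨k, hk₀, hk⟩ := ((eventually_ge_atTop k₀).and
    (hsup ((e / (J + 1)) ^ (1 / p)) (Real.rpow_pos_of_pos hJ _))).exists
  have hterm : ∀ j, ‖x k j‖ₑ ^ p ≤ ENNReal.ofReal (e / (J + 1)) := by
    intro j
    rw [← ofReal_norm, ENNReal.ofReal_rpow_of_nonneg (norm_nonneg _) hp.le]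
    refine ENNReal.ofReal_le_ofReal ?_
    calc ‖x k j‖ ^ p ≤ ((e / (J + 1)) ^ (1 / p)) ^ p :=
          Real.rpow_le_rpow (norm_nonneg _) (hk j).le hp.le
      _ = e / (J + 1) := by rw [← Real.rpow_mul hJ.le, one_div_mul_cancel hp.ne', Real.rpow_one]
  obtain ⟨φ, hφ, F, hF⟩ : ∃ φ : ℕ → ℕ, StrictMono φ ∧ ∃ F : Finset ℕ, ENNReal.ofReal (2 * e) <
      ∑ n ∈ F, ‖x k (φ n)‖ₑ ^ p * ENNReal.ofReal (w n) := by
    by_contra! hcon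
    have h1 : garlingENorm w p (x k) ≤ ENNReal.ofReal (2 * e) ^ p⁻¹ := by
      rw [garlingENorm_le_iff w hp, ENNReal.rpow_inv_rpow hp.ne']
      exact hcon
    have h2 := (hlow k).trans h1
    rw [ENNReal.le_rpow_inv_iff hp, ENNReal.ofReal_rpow_of_nonneg hc.le hp.le,
      ENNReal.ofReal_le_ofReal_iff (by positivity)] at h2
    linarith
  have hhead : ∑ n ∈ F.filter (fun n => ¬ J ≤ n), ‖x k (φ n)‖ₑ ^ p * ENNReal.ofReal (w n) ≤
      ENNReal.ofReal e := by
    calc _ ≤ ∑ n ∈ F.filter (fun n => ¬ J ≤ n), ENNReal.ofReal (e / (J + 1)) := by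
          refine Finset.sum_le_sum fun n _ => ?_
          calc _ ≤ ENNReal.ofReal (e / (J + 1)) * 1 := by
                gcongr
                · exact hterm _
                · rw [ENNReal.ofReal_le_one, ← w.first_eq_one]
                  exact w.antitone (Nat.zero_le n)
            _ = _ := mul_one _
      _ ≤ ∑ n ∈ Finset.range J, ENNReal.ofReal (e / (J + 1)) := by
          refine Finset.sum_le_sum_of_subset fun n hn => ?_
          simpa using (Finset.mem_filter.1 hn).2
      _ = ENNReal.ofReal (J * (e / (J + 1))) := by
          rw [Finset.sum_const, Finset.card_range, nsmul_eq_mul,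
            ENNReal.ofReal_mul (Nat.cast_nonneg J), ENNReal.ofReal_natCast]
      _ ≤ ENNReal.ofReal e := by
          refine ENNReal.ofReal_le_ofReal ?_
          rw [← mul_div_assoc, div_le_iff₀ (by positivity)]
          nlinarith
  have htail : ENNReal.ofReal e ≤
      ∑ n ∈ F.filter (fun n => J ≤ n), ‖x k (φ n)‖ₑ ^ p * ENNReal.ofReal (w n) := by
    by_contra! hcon
    rw [← Finset.sum_filter_add_sum_filter_not F (fun n => J ≤ n)] at hF
    have := hF.trans_le (add_le_add hcon.le hhead)
    rw [← ENNReal.ofReal_add he.le he.le, two_mul] at this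
    exact lt_irrefl _ this
  refine ⟨k, hk₀, (F.filter (fun n => J ≤ n)).image φ, ?_, htail.trans ?_⟩
  · intro a ha
    obtain ⟨n, hn, rfl⟩ := Finset.mem_image.1 ha
    exact (Finset.mem_filter.1 hn).2.trans (hφ.le_apply)
  · rw [Finset.sum_image hφ.injective.injOn]
    refine Finset.sum_le_sum fun n hn => ?_
    gcongr
    -- The elements of the image below `φ n` come from `[J, n)`, so `J` plus the rank is at most
    -- `n`.
    refine w.antitone ?_
    have hJn : J ≤ n := (Finset.mem_filter.1 hn).2
    have hsub : ((F.filter (fun n => J ≤ n)).image φ).filter (· < φ n) ⊆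
        (Finset.Ico J n).image φ := by
      intro b hb
      simp only [Finset.mem_filter, Finset.mem_image, Finset.mem_Ico] at hb ⊢
      obtain ⟨⟨m, hm, rfl⟩, h⟩ := hb
      exact ⟨m, ⟨hm.2, hφ.lt_iff_lt.1 h⟩, rfl⟩
    have := (Finset.card_le_card hsub).trans Finset.card_image_le
    rw [Nat.card_Ico] at this
    omega

/-- Blocks are concatenated: the new one lies beyond `J`, a strict upper bound of `A`. As `A.card ≤
J`, an element's rank in the union is at most `J` plus its rank in the new block, and the shifted
weights suffice. -/
theorem exists_selection_sum_ge (hp : 0 < p) {x : ℕ → ℕ → 𝕜}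
    (hsup : ∀ δ : ℝ, 0 < δ → ∀ᶠ k in atTop, ∀ j, ‖x k j‖ < δ) {c : ℝ} (hc : 0 < c)
    (hlow : ∀ k, ENNReal.ofReal c ≤ garlingENorm w p (x k)) (N : ℕ) :
    ∃ (K A : Finset ℕ) (σ : ℕ → ℕ), K.card = N ∧ (∀ a ∈ A, σ a ∈ K) ∧
      (N : ℝ≥0∞) * ENNReal.ofReal (c ^ p / 4) ≤
        ∑ a ∈ A, ‖x (σ a) a‖ₑ ^ p * ENNReal.ofReal (w (A.filter (· < a)).card) := by
  classical
  induction N with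
  | zero => exact ⟨∅, ∅, id, by simp⟩
  | succ N ih =>
    obtain ⟨K, A, σ, hK, hσ, hsum⟩ := ih
    obtain ⟨J, hJ⟩ : ∃ J, ∀ a ∈ A, a < J :=
      ⟨A.sup id + 1, fun a ha => Nat.lt_succ_of_le (Finset.le_sup (f := id) ha)⟩
    obtain ⟨k, hk, A', hA', hsum'⟩ := exists_tail_sum_ge w hp hsup hc hlow J (K.sup id + 1)
    have hkK : k ∉ K := fun h => by
      have := Finset.le_sup (f := id) h
      simp only [id] at this
      omega
    have hdisj : Disjoint A A' := Finset.disjoint_left.2 fun a h h' =>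
      absurd (hJ a h) (not_lt.2 (hA' a h'))
    refine ⟨insert k K, A ∪ A', fun a => if a < J then σ a else k, ?_, ?_, ?_⟩
    · rw [Finset.card_insert_of_notMem hkK, hK]
    · intro a ha
      rcases Finset.mem_union.1 ha with h | h
      · simp [hJ a h, hσ a h]
      · simp [not_lt.2 (hA' a h)]
    · rw [Finset.sum_union hdisj, Nat.cast_succ, add_mul, one_mul]
      refine add_le_add (hsum.trans (Finset.sum_le_sum fun a ha => ?_))
        (hsum'.trans (Finset.sum_le_sum fun a ha => ?_))
      · have hr : (A ∪ A').filter (· < a) = A.filter (· < a) := by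
          ext b
          simp only [Finset.mem_filter, Finset.mem_union]
          refine ⟨fun ⟨h, hb⟩ => ⟨h.resolve_right fun h' => ?_, hb⟩,
            fun ⟨h, hb⟩ => ⟨Or.inl h, hb⟩⟩
          have := hA' b h'
          have := hJ a ha
          omega
        simp only [hr, if_pos (hJ a ha), le_refl]
      · simp only [if_neg (not_lt.2 (hA' a ha))]
        gcongr
        refine w.antitone ?_
        have hAJ : A.card ≤ J := by
          simpa using Finset.card_le_card
            (fun b hb => Finset.mem_range.2 (hJ b hb) : A ⊆ Finset.range J)
        rw [Finset.filter_union]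
        have := Finset.card_union_le (A.filter (· < a)) (A'.filter (· < a))
        have := Finset.card_filter_le A (· < a)
        omega

theorem tendsto_average_zero : Tendsto (fun N : ℕ => (N : ℝ)⁻¹ * ∑ n ∈ Finset.range N, w n)
    atTop (𝓝 0) := by
  simpa using w.tendsto_zero.cesaro

/-- The indicator of `N` indices, used as coefficients, has `v`-norm to the power `p` at most a
partial sum of `v`, while the selection built from it has `w`-norm to the power `p` at least `N *
e`. Dividing by `N` contradicts the vanishing of the Cesàro means of `v`. -/
theorem false_of_uniformly_small (hp : 1 ≤ p) {x : ℕ → ℕ → 𝕜} {C : ℝ≥0∞} (hC : C ≠ ∞)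
    (hsel : ∀ (N : ℕ) (a : ℕ → 𝕜), (∀ k, N ≤ k → a k = 0) → ∀ c : ℕ → ℕ,
      garlingENorm w p (fun j => a (c j) * x (c j) j) ≤ C * garlingENorm v p a)
    (hsup : ∀ δ : ℝ, 0 < δ → ∀ᶠ k in atTop, ∀ j, ‖x k j‖ < δ) {c : ℝ} (hc : 0 < c)
    (hlow : ∀ k, ENNReal.ofReal c ≤ garlingENorm w p (x k)) : False := by
  have h0 : 0 < p := zero_lt_one.trans_le hp
  set e : ℝ := c ^ p / 4 with he_def
  have he : 0 < e := by
    have := Real.rpow_pos_of_pos hc p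
    positivity
  have hCp : C ^ p ≠ ∞ := ENNReal.rpow_ne_top_of_nonneg h0.le hC
  have hbound : ∀ N : ℕ, (N : ℝ) * e ≤ (C ^ p).toReal * ∑ n ∈ Finset.range N, v n := by
    intro N
    obtain ⟨K, A, σ, hK, hσ, hsum⟩ := exists_selection_sum_ge w h0 hsup hc hlow N
    let a : ℕ → 𝕜 := Set.indicator (K : Set ℕ) 1
    have h1 : (N : ℝ≥0∞) * ENNReal.ofReal e ≤
        garlingENorm w p (fun j => a (σ j) * x (σ j) j) ^ p := by
      refine hsum.trans (le_trans (le_of_eq ?_) (sum_rank_le_garlingENorm w h0 _ A))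
      refine Finset.sum_congr rfl fun b hb => ?_
      simp [a, hσ b hb]
    have h2 := hsel (K.sup id + 1) a (fun k hk => Set.indicator_of_notMem (fun h => by
      have := Finset.le_sup (f := id) (Finset.mem_coe.1 h)
      simp only [id] at this
      omega) _) σ
    have h3 := h1.trans (ENNReal.rpow_le_rpow h2 h0.le)
    rw [ENNReal.mul_rpow_of_nonneg _ _ h0.le] at h3
    have h4 : (N : ℝ≥0∞) * ENNReal.ofReal e ≤
        C ^ p * ENNReal.ofReal (∑ n ∈ Finset.range N, v n) := by
      refine h3.trans ?_
      gcongr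
      simpa [hK] using garlingENorm_indicator_rpow_le (𝕜 := 𝕜) v h0 K
    have h5 := ENNReal.toReal_mono (ENNReal.mul_ne_top hCp ENNReal.ofReal_ne_top) h4
    rwa [ENNReal.toReal_mul, ENNReal.toReal_mul, ENNReal.toReal_natCast,
      ENNReal.toReal_ofReal he.le,
      ENNReal.toReal_ofReal (Finset.sum_nonneg fun n _ => (v.pos n).le)] at h5
  have hlim := (tendsto_average_zero v).const_mul (C ^ p).toReal
  rw [mul_zero] at hlim
  refine absurd (ge_of_tendsto hlim ?_) (not_le.2 he)
  filter_upwards [eventually_gt_atTop 0] with N hN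
  have hN' : (0 : ℝ) < N := Nat.cast_pos.2 hN
  have := hbound N
  rw [mul_left_comm, inv_mul_eq_div, le_div_iff₀ hN']
  linarith

end Selection

/-! ### Completeness, and spaces that coincide as sets. -/

namespace GarlingSpace

variable {𝕜 : Type*} [RCLike 𝕜] {v w : GarlingWeight} {p : ℝ} [hp : Fact (1 ≤ p)]

/-- The inclusion of `g(w, p)` into the space of all sequences. -/
def coordL (𝕜 : Type*) [RCLike 𝕜] (w : GarlingWeight) (p : ℝ) [Fact (1 ≤ p)] :
    GarlingSpace 𝕜 w p →ₗ[𝕜] (ℕ → 𝕜) :=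
  (garlingSubmodule 𝕜 w p).subtype

/-- The element of `g(w, p)` given by a sequence of finite Garling norm. -/
def mk (f : ℕ → 𝕜) (hf : garlingENorm w p f < ∞) : GarlingSpace 𝕜 w p := ⟨f, hf⟩

@[simp]
theorem coordL_mk (f : ℕ → 𝕜) (hf : garlingENorm w p f < ∞) : coordL 𝕜 w p (mk f hf) = f := rfl

theorem coordL_injective : Function.Injective (coordL 𝕜 w p) := Subtype.val_injective

theorem garlingENorm_coordL_lt_top (f : GarlingSpace 𝕜 w p) :
    garlingENorm w p (coordL 𝕜 w p f) < ∞ := f.2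

theorem enorm_eq (f : GarlingSpace 𝕜 w p) : ‖f‖ₑ = garlingENorm w p (coordL 𝕜 w p f) := by
  rw [← ofReal_norm]
  exact ENNReal.ofReal_toReal (garlingENorm_coordL_lt_top f).ne

theorem norm_coordL_apply_le (f : GarlingSpace 𝕜 w p) (j : ℕ) : ‖coordL 𝕜 w p f j‖ ≤ ‖f‖ := by
  rw [← enorm_le_iff_norm_le, enorm_eq]
  exact enorm_apply_le_garlingENorm w (zero_lt_one.trans_le hp.out) _ j

theorem tendsto_coordL_apply {ι : Type*} {l : Filter ι} {u : ι → GarlingSpace 𝕜 w p}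
    {f : GarlingSpace 𝕜 w p} (h : Tendsto u l (𝓝 f)) (j : ℕ) :
    Tendsto (fun i => coordL 𝕜 w p (u i) j) l (𝓝 (coordL 𝕜 w p f j)) := by
  rw [tendsto_iff_norm_sub_tendsto_zero] at h ⊢
  refine squeeze_zero (fun _ => norm_nonneg _) (fun i => ?_) h
  simpa using norm_coordL_apply_le (u i - f) j

/-- The coordinatewise limit of a Cauchy sequence is its norm limit by the Fatou property.
Completeness is what the closed graph theorem needs. -/
instance : CompleteSpace (GarlingSpace 𝕜 w p) := by
  have h0 : 0 < p := zero_lt_one.trans_le hp.out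
  refine UniformSpace.complete_of_cauchySeq_tendsto fun u hu => ?_
  have hcoord : ∀ j, ∃ y, Tendsto (fun n => coordL 𝕜 w p (u n) j) atTop (𝓝 y) := by
    refine fun j => cauchySeq_tendsto_of_complete (Metric.cauchySeq_iff.2 fun ε hε => ?_)
    obtain ⟨N, hN⟩ := Metric.cauchySeq_iff.1 hu ε hε
    refine ⟨N, fun m hm n hn => lt_of_le_of_lt ?_ (hN m hm n hn)⟩
    rw [dist_eq_norm, dist_eq_norm]
    simpa using norm_coordL_apply_le (u m - u n) j
  choose y hy using hcoord
  have hlim : ∀ ε : ℝ, 0 < ε → ∃ N, ∀ n ≥ N,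
      garlingENorm w p (coordL 𝕜 w p (u n) - y) ≤ ENNReal.ofReal ε := by
    intro ε hε
    obtain ⟨N, hN⟩ := Metric.cauchySeq_iff.1 hu ε hε
    refine ⟨N, fun n hn => ?_⟩
    refine garlingENorm_le_of_tendsto w h0 (l := atTop)
      (u := fun m => coordL 𝕜 w p (u n) - coordL 𝕜 w p (u m))
      (fun j => (hy j).const_sub _) ?_
    filter_upwards [eventually_ge_atTop N] with m hm
    rw [← map_sub, ← enorm_eq, ← ofReal_norm, ← dist_eq_norm]
    exact ENNReal.ofReal_le_ofReal (hN n hn m hm).le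
  have hyfin : garlingENorm w p y < ∞ := by
    obtain ⟨N, hN⟩ := hlim 1 one_pos
    have : y = coordL 𝕜 w p (u N) + -(coordL 𝕜 w p (u N) - y) := by abel
    rw [this]
    refine (garlingENorm_add_le w hp.out _ _).trans_lt (ENNReal.add_lt_top.2
      ⟨garlingENorm_coordL_lt_top _, ?_⟩)
    rw [garlingENorm_neg w h0]
    exact (hN N le_rfl).trans_lt ENNReal.ofReal_lt_top
  refine ⟨mk y hyfin, Metric.tendsto_atTop.2 fun ε hε => ?_⟩
  obtain ⟨N, hN⟩ := hlim (ε / 2) (half_pos hε)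
  refine ⟨N, fun n hn => ?_⟩
  have h := hN n hn
  rw [← coordL_mk (𝕜 := 𝕜) y hyfin, ← map_sub, ← enorm_eq, ← ofReal_norm, ← dist_eq_norm,
    ENNReal.ofReal_le_ofReal_iff (half_pos hε).le] at h
  exact h.trans_lt (half_lt_self hε)

/-- If two Garling spaces coincide as sets, then the identity is an isomorphism between them. -/
theorem exists_equiv_of_coe_eq
    (h : (garlingSubmodule 𝕜 v p : Set (ℕ → 𝕜)) = (garlingSubmodule 𝕜 w p : Set (ℕ → 𝕜))) :
    ∃ T : GarlingSpace 𝕜 v p ≃L[𝕜] GarlingSpace 𝕜 w p,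
      ∀ f, coordL 𝕜 w p (T f) = coordL 𝕜 v p f := by
  let e : GarlingSpace 𝕜 v p ≃ₗ[𝕜] GarlingSpace 𝕜 w p :=
    LinearEquiv.ofEq (garlingSubmodule 𝕜 v p) (garlingSubmodule 𝕜 w p) (SetLike.coe_injective h)
  have he : ∀ f, coordL 𝕜 w p (e f) = coordL 𝕜 v p f := fun f => rfl
  have hcont : Continuous e := by
    -- The graph is closed because convergence in either norm forces convergence of every
    -- coordinate, and coordinate limits are unique.
    refine e.toLinearMap.continuous_of_seq_closed_graph fun u x y hu hy => ?_
    refine coordL_injective (funext fun j => ?_)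
    refine tendsto_nhds_unique (tendsto_coordL_apply hy j) ?_
    exact tendsto_coordL_apply hu j
  exact ⟨e.toContinuousLinearEquivOfContinuous hcont, he⟩

theorem exists_garlingENorm_le_of_coe_eq
    (h : (garlingSubmodule 𝕜 v p : Set (ℕ → 𝕜)) = (garlingSubmodule 𝕜 w p : Set (ℕ → 𝕜))) :
    ∃ C : ℝ≥0∞, C ≠ ∞ ∧ ∀ f : ℕ → 𝕜, garlingENorm v p f < ∞ →
      garlingENorm w p f ≤ C * garlingENorm v p f := by
  obtain ⟨T, hT⟩ := exists_equiv_of_coe_eq h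
  refine ⟨‖(T : GarlingSpace 𝕜 v p →L[𝕜] GarlingSpace 𝕜 w p)‖ₑ, enorm_ne_top, fun f hf => ?_⟩
  have := (T : GarlingSpace 𝕜 v p →L[𝕜] GarlingSpace 𝕜 w p).le_opENorm (mk f hf)
  simpa [enorm_eq, hT] using this

/-! ### The canonical basis and isomorphisms between Garling spaces. -/

theorem garlingENorm_single_le (w : GarlingWeight) (j : ℕ) :
    garlingENorm w p (Pi.single j (1 : 𝕜)) ≤ 1 := by
  have h0 : 0 < p := zero_lt_one.trans_le hp.out
  have h := garlingENorm_indicator_rpow_le (𝕜 := 𝕜) w h0 {j}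
  have hs : Set.indicator (({j} : Finset ℕ) : Set ℕ) (1 : ℕ → 𝕜) = Pi.single j 1 := by
    funext n
    by_cases hn : n = j
    · subst hn; simp
    · simp [hn]
  rw [hs] at h
  rw [← ENNReal.rpow_le_rpow_iff h0, ENNReal.one_rpow]
  simpa [w.first_eq_one] using h

variable (𝕜 w p) in
/-- The canonical basis of `g(w, p)`. -/
def basis (j : ℕ) : GarlingSpace 𝕜 w p :=
  mk (Pi.single j 1) ((garlingENorm_single_le w j).trans_lt ENNReal.one_lt_top)

@[simp]
theorem coordL_basis (j : ℕ) : coordL 𝕜 w p (basis 𝕜 w p j) = Pi.single j 1 := rfl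

theorem norm_basis_le (j : ℕ) : ‖basis 𝕜 w p j‖ ≤ 1 := by
  rw [← ENNReal.ofReal_le_one, ofReal_norm, enorm_eq]
  exact garlingENorm_single_le w j

theorem coordL_sum_smul_basis {N : ℕ} {a : ℕ → 𝕜} (ha : ∀ k, N ≤ k → a k = 0) {l : ℕ → ℕ}
    (hl : StrictMono l) :
    coordL 𝕜 w p (∑ k ∈ Finset.range N, a k • basis 𝕜 w p (l k)) = Function.extend l a 0 := by
  rw [map_sum]
  funext j
  simp only [map_smul, coordL_basis, Finset.sum_apply, Pi.smul_apply, smul_eq_mul]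
  by_cases hj : ∃ n, l n = j
  · obtain ⟨n, rfl⟩ := hj
    rw [hl.injective.extend_apply]
    by_cases hn : n < N
    · rw [Finset.sum_eq_single n]
      · simp
      · intro k _ hk
        rw [Pi.single_eq_of_ne (fun h => hk (hl.injective h).symm), mul_zero]
      · exact fun h => absurd (Finset.mem_range.2 hn) h
    · rw [ha n (not_lt.1 hn)]
      refine Finset.sum_eq_zero fun k hk => ?_
      have hkn : n ≠ k := fun h => hn (h ▸ Finset.mem_range.1 hk)
      rw [Pi.single_eq_of_ne (fun h => hkn (hl.injective h)), mul_zero]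
  · rw [Function.extend_apply' _ _ _ hj]
    refine Finset.sum_eq_zero fun k _ => ?_
    rw [Pi.single_eq_of_ne (fun h => hj ⟨k, h.symm⟩), mul_zero]

/-- Each of the two spread copies of `a` has norm at most that of `a`, hence the factor 2. -/
theorem enorm_sum_smul_sub_le {N : ℕ} {a : ℕ → 𝕜} (ha : ∀ k, N ≤ k → a k = 0) {l l' : ℕ → ℕ}
    (hl : StrictMono l) (hl' : StrictMono l') :
    ‖∑ k ∈ Finset.range N, a k • (basis 𝕜 w p (l k) - basis 𝕜 w p (l' k))‖ₑ ≤
      2 * garlingENorm w p a := by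
  have h0 : 0 < p := zero_lt_one.trans_le hp.out
  simp only [smul_sub, Finset.sum_sub_distrib]
  rw [enorm_eq, map_sub, coordL_sum_smul_basis ha hl, coordL_sum_smul_basis ha hl',
    sub_eq_add_neg, two_mul]
  refine (garlingENorm_add_le w hp.out _ _).trans (add_le_add ?_ ?_)
  · exact garlingENorm_extend_le w h0 a hl
  · rw [garlingENorm_neg w h0]
    exact garlingENorm_extend_le w h0 a hl'

theorem exists_garlingENorm_le_of_equiv_of_finite
    (T : GarlingSpace 𝕜 v p ≃L[𝕜] GarlingSpace 𝕜 w p) :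
    ∃ C : ℝ≥0∞, C ≠ ∞ ∧ ∀ (N : ℕ) (a : ℕ → 𝕜), (∀ k, N ≤ k → a k = 0) →
      garlingENorm w p a ≤ C * garlingENorm v p a := by
  have h0 : 0 < p := zero_lt_one.trans_le hp.out
  let S : GarlingSpace 𝕜 v p →L[𝕜] GarlingSpace 𝕜 w p := T
  let S' : GarlingSpace 𝕜 w p →L[𝕜] GarlingSpace 𝕜 v p := T.symm
  obtain ⟨y, m, hm, hy⟩ := exists_tendsto_subseq_of_bounded
    (u := fun k => coordL 𝕜 w p (S (basis 𝕜 v p k))) (R := ‖S‖) fun k j =>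
      (norm_coordL_apply_le _ j).trans
        ((S.le_opNorm _).trans (mul_le_of_le_one_right (norm_nonneg _) (norm_basis_le k)))
  have hodd : StrictMono fun k => 2 * k + 1 := fun a b h => by simpa using h
  have heven : StrictMono fun k => 2 * k := fun a b h => by simpa using h
  -- The coordinatewise limit `y` of the images need not vanish; taking differences cancels it.
  let d : ℕ → GarlingSpace 𝕜 v p := fun k => basis 𝕜 v p (m (2 * k + 1)) - basis 𝕜 v p (m (2 * k))
  let x : ℕ → ℕ → 𝕜 := fun k => coordL 𝕜 w p (S (d k))
  have hx : ∀ j, Tendsto (fun k => x k j) atTop (𝓝 0) := by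
    intro j
    have := ((hy j).comp hodd.tendsto_atTop).sub ((hy j).comp heven.tendsto_atTop)
    simpa [x, d, Function.comp_def] using this
  -- Changing signs of the coefficients leaves their `v`-norm unchanged, so all signed sums share
  -- one bound.
  have hsel : ∀ (N : ℕ) (a : ℕ → 𝕜), (∀ k, N ≤ k → a k = 0) → ∀ c : ℕ → ℕ,
      garlingENorm w p (fun j => a (c j) * x (c j) j) ≤ (‖S‖ₑ * 2) * garlingENorm v p a := by
    intro N a ha c
    have heq : (fun j => a (c j) * x (c j) j) =
        fun j => if c j < N then (a (c j) • x (c j)) j else 0 := by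
      funext j
      split_ifs with h
      · rfl
      · rw [ha _ (not_lt.1 h), zero_mul]
    rw [heq]
    refine garlingENorm_select_le w hp.out c N (fun k => a k • x k) fun ε hε => ?_
    have hsum : ∑ k ∈ Finset.range N, ε k • a k • x k =
        coordL 𝕜 w p (S (∑ k ∈ Finset.range N, (ε k * a k) • d k)) := by
      simp [x, map_sum, mul_smul]
    rw [hsum, ← enorm_eq, mul_assoc]
    refine (S.le_opENorm _).trans ?_
    gcongr
    refine (enorm_sum_smul_sub_le (a := fun k => ε k * a k)
      (fun k hk => by simp [ha k hk]) (hm.comp hodd) (hm.comp heven)).trans ?_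
    gcongr
    refine garlingENorm_mono v h0 fun k => ?_
    rcases hε k with h | h <;> simp [h]
  have hC : ‖S‖ₑ * 2 ≠ ∞ := ENNReal.mul_ne_top enorm_ne_top ENNReal.ofNat_ne_top
  -- Each `d k` has a coordinate equal to 1, and the inverse operator carries this bound over to `x
  -- k`. Adding 1 to `‖S'‖` keeps the inverted number positive.
  have hlow : ∀ k, ENNReal.ofReal (‖S'‖ + 1)⁻¹ ≤ garlingENorm w p (x k) := by
    intro k
    rw [← enorm_eq, ← ofReal_norm]
    refine ENNReal.ofReal_le_ofReal ?_
    have h1 : 1 ≤ ‖d k‖ := by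
      refine le_trans (le_of_eq ?_) (norm_coordL_apply_le (d k) (m (2 * k + 1)))
      have : m (2 * k + 1) ≠ m (2 * k) := fun h => by
        have := hm.injective h
        omega
      simp [d, this]
    have h2 : ‖d k‖ ≤ ‖S'‖ * ‖S (d k)‖ := by
      simpa [S, S'] using S'.le_opNorm (S (d k))
    rw [inv_le_iff_one_le_mul₀' (by positivity)]
    nlinarith [norm_nonneg (S (d k))]
  by_cases hsup : ∀ δ : ℝ, 0 < δ → ∀ᶠ k in atTop, ∀ j, ‖x k j‖ < δ
  · exact (false_of_uniformly_small v w hp.out hC hsel hsup (by positivity) hlow).elim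
  · push Not at hsup
    obtain ⟨δ, hδ, hfreq⟩ := hsup
    refine ⟨(ENNReal.ofReal δ)⁻¹ * (‖S‖ₑ * 2), ENNReal.mul_ne_top (by simpa using hδ) hC,
      fun N a ha => ?_⟩
    rw [mul_assoc, mul_comm, ← div_eq_mul_inv, ENNReal.le_div_iff_mul_le
      (Or.inl (by simpa using hδ)) (Or.inl ENNReal.ofReal_ne_top), mul_comm]
    exact garlingENorm_le_of_frequently_le v w hp.out hsel hx hδ hfreq N a ha

/-- Truncations of `a` have `v`-norm at most that of `a` and converge to it coordinatewise, so the
Fatou property applies. -/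
theorem exists_garlingENorm_le_of_equiv (T : GarlingSpace 𝕜 v p ≃L[𝕜] GarlingSpace 𝕜 w p) :
    ∃ C : ℝ≥0∞, C ≠ ∞ ∧ ∀ a : ℕ → 𝕜, garlingENorm w p a ≤ C * garlingENorm v p a := by
  have h0 : 0 < p := zero_lt_one.trans_le hp.out
  obtain ⟨C, hC, h⟩ := exists_garlingENorm_le_of_equiv_of_finite T
  refine ⟨C, hC, fun a => ?_⟩
  refine garlingENorm_le_of_tendsto w h0 (l := atTop)
    (u := fun N => Set.indicator (Finset.range N : Set ℕ) a) (fun j => ?_)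
    (Eventually.of_forall fun N => (h N _ fun k hk => ?_).trans ?_)
  · refine tendsto_const_nhds.congr' ?_
    filter_upwards [eventually_gt_atTop j] with N hN
    simp [hN]
  · exact Set.indicator_of_notMem (by simpa using hk) _
  · gcongr
    refine garlingENorm_mono v h0 fun k => ?_
    by_cases hk : k < N <;> simp [hk]

theorem coe_subset_of_equiv (T : GarlingSpace 𝕜 v p ≃L[𝕜] GarlingSpace 𝕜 w p) :
    (garlingSubmodule 𝕜 v p : Set (ℕ → 𝕜)) ⊆ (garlingSubmodule 𝕜 w p : Set (ℕ → 𝕜)) := by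
  obtain ⟨C, hC, h⟩ := exists_garlingENorm_le_of_equiv T
  exact fun f hf => (h f).trans_lt (ENNReal.mul_lt_top hC.lt_top hf)

/-- With `W` and `V` the sums of the first `n + 1` weights, `(n + 1) * w n ≤ W ≤ C ^ p * V ≤ C ^ p *
D * (n + 1) * v n`: monotonicity of `w`, the norm comparison on an indicator, regularity of `v`. -/
theorem famLesssim_of_coe_eq (hv : v.IsRegular)
    (h : (garlingSubmodule 𝕜 v p : Set (ℕ → 𝕜)) = (garlingSubmodule 𝕜 w p : Set (ℕ → 𝕜))) :
    FamLesssim (fun n => w n) (fun n => v n) := by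
  have h0 : 0 < p := zero_lt_one.trans_le hp.out
  obtain ⟨C, hC, hle⟩ := exists_garlingENorm_le_of_coe_eq h
  obtain ⟨D, hD, hreg⟩ := hv
  have hCp : C ^ p ≠ ∞ := ENNReal.rpow_ne_top_of_nonneg h0.le hC
  refine ⟨(C ^ p).toReal * D, ?_⟩
  rintro _ ⟨n, rfl⟩
  let f : ℕ → 𝕜 := Set.indicator (Finset.range (n + 1) : Set ℕ) 1
  have hf : garlingENorm v p f ^ p ≤ ENNReal.ofReal (∑ i ∈ Finset.range (n + 1), v i) := by
    simpa [f] using garlingENorm_indicator_rpow_le (𝕜 := 𝕜) v h0 (Finset.range (n + 1))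
  have hf' : garlingENorm v p f < ∞ := by
    rw [← ENNReal.rpow_lt_top_iff_of_pos h0]
    exact hf.trans_lt ENNReal.ofReal_lt_top
  have h1 := (sum_range_le_garlingENorm_indicator_rpow (𝕜 := 𝕜) w h0 (n + 1)).trans
    (ENNReal.rpow_le_rpow (hle f hf') h0.le)
  rw [ENNReal.mul_rpow_of_nonneg _ _ h0.le] at h1
  have h2 := ENNReal.toReal_mono (ENNReal.mul_ne_top hCp ENNReal.ofReal_ne_top)
    (h1.trans (mul_le_mul_right hf (C ^ p)))
  rw [ENNReal.toReal_mul, ENNReal.toReal_ofReal (Finset.sum_nonneg fun i _ => (v.pos i).le),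
    ENNReal.toReal_ofReal (Finset.sum_nonneg fun i _ => (w.pos i).le)] at h2
  have h3 : ((n : ℝ) + 1) * w n ≤ ∑ i ∈ Finset.range (n + 1), w i := by
    have := Finset.card_nsmul_le_sum (Finset.range (n + 1)) w.toFun (w n) fun i hi =>
      w.antitone (Nat.lt_succ_iff.1 (Finset.mem_range.1 hi))
    simpa using this
  have hn : (0 : ℝ) < (n : ℝ) + 1 := by positivity
  have h4 : ∑ i ∈ Finset.range (n + 1), v i ≤ ((n : ℝ) + 1) * (D * v n) := by
    have := hreg n
    rwa [one_div, inv_mul_le_iff₀ hn] at this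
  change w n / v n ≤ _
  rw [div_le_iff₀ (v.pos n)]
  refine le_of_mul_le_mul_left ?_ hn
  calc _ ≤ _ := h3.trans h2
    _ ≤ (C ^ p).toReal * (((n : ℝ) + 1) * (D * v n)) := by gcongr
    _ = _ := by ring

end GarlingSpace

theorem corollary2p2 {𝕜 : Type*} [RCLike 𝕜] (p : ℝ) [Fact (1 ≤ p)] (v w : GarlingWeight) :
    (Nonempty (GarlingSpace 𝕜 v p ≃L[𝕜] GarlingSpace 𝕜 w p) ↔
      (garlingSubmodule 𝕜 v p : Set (ℕ → 𝕜)) = (garlingSubmodule 𝕜 w p : Set (ℕ → 𝕜))) ∧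
    (v.IsRegular → w.IsRegular →
      (garlingSubmodule 𝕜 v p : Set (ℕ → 𝕜)) = (garlingSubmodule 𝕜 w p : Set (ℕ → 𝕜)) →
      FamApprox (fun n => v n) (fun n => w n)) := by
  refine ⟨⟨fun ⟨T⟩ => ?_, fun h => ?_⟩, fun hv hw h => ?_⟩
  · exact (GarlingSpace.coe_subset_of_equiv T).antisymm (GarlingSpace.coe_subset_of_equiv T.symm)
  · exact (GarlingSpace.exists_equiv_of_coe_eq h).nonempty
  · exact ⟨GarlingSpace.famLesssim_of_coe_eq hw h.symm, GarlingSpace.famLesssim_of_coe_eq hv h⟩
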